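/- Let $\mathbb{F}_q$ be the finite field with $q$ elements, let $V$ and $E$ be vector spaces over $\mathbb{F}_q$ of finite dimensions $n$ and $l$, and let $0\le m\le n$. Write $a\wedge b=\min\{a,b\}$ and $d=m\wedge(n-m)$. For integers $a,b$ let $\left[{a\atop b}\right]=\prod_{i=0}^{b-1}\frac{q^a-q^i}{q^b-q^i}$ if $b\ge 0$ and $\left[{a\atop b}\right]=0$ if $b<0$, and let $$K_k(N,l;q;x)=\sum_{j=0}^{k}(-1)^{k-j}q^{jl+\binom{k-j}{2}}\left[{N-j\atop N-k}\right]\left[{N-x\atop j}\right]$$ be the generalized Krawtchouk polynomials. Let $\mathcal{X}_m$ be the set of all pairs $(\mathfrak{x},\xi)$ of an $m$-dimensional subspace $\mathfrak{x}$ of $V$ and a linear map $\xi:\mathfrak{x}\to E$. For $i,j\ge 0$ let $A_{(i,j)}$ be the complex matrix with rows and columns indexed by $\mathcal{X}_m$ whose $((\mathfrak{x},\xi),(\mathfrak{y},\eta))$-entry is $1$ if $\dim(\mathfrak{x}\cap\mathfrak{y})=m-i$ and $\operatorname{rank}(\xi|_{\mathfrak{x}\cap\mathfrak{y}}-\eta|_{\mathfrak{x}\cap\mathfrak{y}})=j$,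 and $0$ otherwise. For $0\le i\le d$ and $0\le s\le m\wedge l$ put $$B_{(i,s)}=\sum_{j=0}^{(m-i)\wedge l}K_s(m-i,l;q;j)\,A_{(i,j)},$$ and for $(r,s)\in L=\{(r,s)\in\mathbb{Z}_{\ge 0}^2 : s\le m\wedge l,\ r\le m,\ 0\le r-s\le d\}$ put $$C_{(r,s)}=\sum_{i=0}^{d\wedge(m-s)}\left[{m-i-s\atop r-s}\right]B_{(i,s)}.$$ Then for all $(r,s),(k,h)\in L$, $$C_{(r,s)}C_{(k,h)}=\sum_{i=s}^{r\wedge k}\beta_{(r,s;k,h)}(i,s)\,C_{(i,s)},$$ where $$\beta_{(r,s;k,h)}(i,s)=\delta_{s,h}\,q^{ml+(i-s)(m-r-k+i)}\left[{m-i\atop m-r}\right]\left[{m-i\atop m-k}\right]\left[{n-r-k+s\atop m-r-k+i}\right].$$ (A sum whose lower limit exceeds its upper limit is $0$.) -/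

import Mathlib

noncomputable section

namespace Attenuated

open Module

/-- The Gaussian coefficient `[a, b]_q = ∏_{i < b} (q ^ a - q ^ i) / (q ^ b - q ^ i)`, for integers
`a` and `b`, with the usual convention that it is `0` for `b < 0`. -/
def gaussBinom (q : ℕ) (a b : ℤ) : ℂ :=
  if b < 0 then 0
  else ∏ i ∈ Finset.range b.toNat,
    ((q : ℂ) ^ a - (q : ℂ) ^ i) / ((q : ℂ) ^ b - (q : ℂ) ^ i)

/-- The generalized Krawtchouk polynomial `K_k(n, l; q; x)`:
`∑_{j=0}^k (-1)^(k-j) q^(j l + binom (k-j) 2) [n-j, n-k] [n-x, j]`. -/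
def krawtchouk (q : ℕ) (k n l x : ℕ) : ℂ :=
  ∑ j ∈ Finset.range (k + 1),
    (-1 : ℂ) ^ (k - j) * (q : ℂ) ^ (j * l + (k - j).choose 2) *
      gaussBinom q ((n : ℤ) - j) ((n : ℤ) - k) * gaussBinom q ((n : ℤ) - x) j

section Scheme

variable (F V E : Type*) [Field F] [AddCommGroup V] [Module F V] [AddCommGroup E] [Module F E]

/-- The set `X_m` of all pairs `(x, ξ)` of an `m`-dimensional subspace `x` of `V` and a linear map
`ξ : x → E`. -/
abbrev Pairs (m : ℕ) : Type _ :=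
  Σ x : {x : Submodule F V // finrank F x = m}, (x.1 →ₗ[F] E)

instance instFintypePairs [Finite F] [FiniteDimensional F V] [FiniteDimensional F E] (m : ℕ) :
    Fintype (Pairs F V E m) :=
  haveI : Finite V := Module.finite_of_finite F
  haveI : Finite E := Module.finite_of_finite F
  haveI : Finite (Submodule F V) := Finite.of_injective _ SetLike.coe_injective
  haveI (x : {x : Submodule F V // finrank F x = m}) : Finite (x.1 →ₗ[F] E) :=
    Finite.of_injective _ DFunLike.coe_injective
  Fintype.ofFinite _

variable {F V E}

/-- The difference `ξ|_{x ∩ y} - η|_{x ∩ y}` of the restrictions to the intersection. -/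
def restrictDiff {m : ℕ} (p p' : Pairs F V E m) :
    (p.1.1 ⊓ p'.1.1 : Submodule F V) →ₗ[F] E :=
  p.2 ∘ₗ Submodule.inclusion inf_le_left - p'.2 ∘ₗ Submodule.inclusion inf_le_right

/-- The relation `S_(i,j)` on `X_m`: `dim (x ∩ y) = m - i` and
`rank (ξ|_{x ∩ y} - η|_{x ∩ y}) = j`. -/
def rel {m : ℕ} (i j : ℕ) (p p' : Pairs F V E m) : Prop :=
  (finrank F (p.1.1 ⊓ p'.1.1 : Submodule F V) : ℤ) = (m : ℤ) - i ∧
    finrank F (LinearMap.range (restrictDiff p p')) = j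

variable (F V E)

open Classical in
/-- The adjacency matrix `A_(i,j)` of the relation `S_(i,j)`. -/
def adjMat (m i j : ℕ) : Matrix (Pairs F V E m) (Pairs F V E m) ℂ :=
  Matrix.of fun p p' => if rel i j p p' then 1 else 0

/-- `B_(i,s) = ∑_{j=0}^{min (m-i) l} K_s(m-i, l; q; j) A_(i,j)`, where `q = |F|`, `l = dim E`
(used for `i ≤ m` only). -/
def matB (m i s : ℕ) : Matrix (Pairs F V E m) (Pairs F V E m) ℂ :=
  ∑ j ∈ Finset.range (min (m - i) (finrank F E) + 1),
    krawtchouk (Nat.card F) s (m - i) (finrank F E) j • adjMat F V E m i j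

/-- `C_(r,s) = ∑_{i=0}^{min d (m-s)} [m-i-s, r-s]_q B_(i,s)`, where `q = |F|`, `n = dim V` and
`d = min m (n-m)` (used for `m ≤ n` and `s ≤ m` only). -/
def matC (m r s : ℕ) : Matrix (Pairs F V E m) (Pairs F V E m) ℂ :=
  ∑ i ∈ Finset.range (min (min m (finrank F V - m)) (m - s) + 1),
    gaussBinom (Nat.card F) ((m : ℤ) - i - s) ((r : ℤ) - s) • matB F V E m i s

end Scheme

/-- The index set `L` of all `(r, s)` with `s ≤ min m l`, `r ≤ m` and `0 ≤ r - s ≤ d`, where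
`d = min m (n-m)` (used for `m ≤ n` only). -/
def indexL (n m l : ℕ) : Set (ℕ × ℕ) :=
  {p | p.2 ≤ min m l ∧ p.1 ≤ m ∧ p.2 ≤ p.1 ∧ p.1 - p.2 ≤ min m (n - m)}

/-- The coefficient `β_{(r,s;k,h)}(i,s)`, equal to
`δ_{s,h} q^(m l + (i-s)(m-r-k+i)) [m-i, m-r] [m-i, m-k] [n-r-k+s, m-r-k+i]`. -/
def beta (q n m l r s k h i : ℕ) : ℂ :=
  (if s = h then 1 else 0) *
    (q : ℂ) ^ ((m : ℤ) * l + ((i : ℤ) - s) * ((m : ℤ) - r - k + i)) *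
    gaussBinom q ((m : ℤ) - i) ((m : ℤ) - r) *
    gaussBinom q ((m : ℤ) - i) ((m : ℤ) - k) *
    gaussBinom q ((n : ℤ) - r - k + s) ((m : ℤ) - r - k + i)

end Attenuated

end

/-!
The proof diagonalizes the problem with a nontrivial additive character `ψ` of `F`. For
`τ : E → V` let `phase ψ · τ` be the function on pairs with value `ψ (tr (ξ τ))` at `(x, ξ)` when
the range of `τ` lies in `x`, and `0` otherwise.

The generalized Krawtchouk polynomial `K_s(N, l; q; x)` is the sum of `ψ (tr (σ τ))` over the maps
`τ` of rank `s` into an `N`-dimensional space, for any fixed `σ` of rank `x`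
(`sum_addChar_trace_eq_krawtchouk`): the sums over all `τ` with range in a given subspace follow
from orthogonality, and Gaussian inversion (`sum_gaussBinom_inversion`) isolates the rank. Since
`[a - s, r - s]` counts the `r`-dimensional subspaces between an `s`-dimensional and an
`a`-dimensional one, `C_(r,s)` is the sum over all `τ` of rank `s` of `phase ψ p τ` times the
conjugate of `phase ψ p' τ`, weighted by the number of `r`-dimensional `u` with
`range τ ≤ u ≤ x ∩ y` (`matC_apply_eq_sum`).

In a product of two such matrices, the sum over the linear map of the middle pair forces the two
maps `τ` to agree, at the cost of a factor `q ^ (m l)` (`sum_phase_inv_mul_phase`). This gives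
`δ_{s,h}` and leaves, for each `τ`, the number of triples `(u, z, u')` with `u` between `range τ`
and `x ∩ z`, and `u'` between `range τ` and `z ∩ y`. That number depends on `u` and `u'` only through
the dimension of `u ∩ u'`, and the `q`-Vandermonde identity rewrites it in terms of the subspaces
`w` of `x ∩ y` containing `range τ` (`sum_intervalCount_mul_intervalCount`); this is the product
rule of the Grassmann scheme of `V / range τ`.
-/

noncomputable section

namespace Attenuated

open Module

/-! ### Gaussian coefficients -/

/-- The numerator `∏_{i < b} (q ^ a - q ^ i)` of the Gaussian coefficient. -/
def gaussNum (q : ℕ) (a : ℤ) (b : ℕ) : ℂ :=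
  ∏ i ∈ Finset.range b, ((q : ℂ) ^ a - (q : ℂ) ^ i)

theorem gaussBinom_natCast (q : ℕ) (a : ℤ) (b : ℕ) :
    gaussBinom q a b = gaussNum q a b / gaussNum q b b := by
  simp [gaussBinom, gaussNum, Finset.prod_div_distrib]

theorem gaussBinom_of_neg (q : ℕ) (a : ℤ) {b : ℤ} (hb : b < 0) : gaussBinom q a b = 0 := by
  simp [gaussBinom, hb]

@[simp]
theorem gaussBinom_zero_right (q : ℕ) (a : ℤ) : gaussBinom q a 0 = 1 := by
  simp [gaussBinom]

theorem gaussBinom_of_lt (q : ℕ) {a b : ℕ} (h : a < b) : gaussBinom q a b = 0 := by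
  rw [gaussBinom_natCast, gaussNum, Finset.prod_eq_zero (Finset.mem_range.2 h) (by simp), zero_div]

theorem gaussNum_succ (q : ℕ) (a : ℤ) (b : ℕ) :
    gaussNum q a (b + 1) = gaussNum q a b * ((q : ℂ) ^ a - (q : ℂ) ^ b) :=
  Finset.prod_range_succ _ _

theorem natCast_pow_sub_one_ne_zero {q : ℕ} (hq : 1 < q) (b : ℕ) : (q : ℂ) ^ (b + 1) - 1 ≠ 0 := by
  rw [sub_ne_zero]
  exact_mod_cast (Nat.one_lt_pow (Nat.succ_ne_zero b) hq).ne'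

theorem gaussNum_succ_succ {q : ℕ} (hq : 1 < q) (a : ℤ) (b : ℕ) :
    gaussNum q (a + 1) (b + 1) = ((q : ℂ) ^ (a + 1) - 1) * (q : ℂ) ^ b * gaussNum q a b := by
  have h0 : (q : ℂ) ≠ 0 := by exact_mod_cast (by omega : q ≠ 0)
  rw [gaussNum, Finset.prod_range_succ', gaussNum]
  have h : ∀ i ∈ Finset.range b, (q : ℂ) ^ (a + 1) - (q : ℂ) ^ (i + 1) =
      q * ((q : ℂ) ^ a - (q : ℂ) ^ i) := fun i _ ↦ by
    rw [zpow_add_one₀ h0]; ring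
  rw [Finset.prod_congr rfl h, Finset.prod_mul_distrib]
  simp; ring

theorem gaussNum_self_ne_zero {q : ℕ} (hq : 1 < q) (b : ℕ) : gaussNum q b b ≠ 0 := by
  have h0 : (q : ℂ) ≠ 0 := by exact_mod_cast (by omega : q ≠ 0)
  induction b with
  | zero => simp [gaussNum]
  | succ b ih =>
    push_cast
    rw [gaussNum_succ_succ hq]
    refine mul_ne_zero (mul_ne_zero ?_ (pow_ne_zero _ h0)) ih
    exact_mod_cast natCast_pow_sub_one_ne_zero hq b

theorem gaussBinom_self {q : ℕ} (hq : 1 < q) (b : ℕ) : gaussBinom q b b = 1 := by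
  rw [gaussBinom_natCast, div_self (gaussNum_self_ne_zero hq b)]

theorem gaussBinom_eq_div_gaussNum_succ {q : ℕ} (hq : 1 < q) (a : ℤ) (c : ℕ) :
    gaussBinom q a c =
      ((q : ℂ) ^ (c + 1) - 1) * q ^ c * gaussNum q a c / gaussNum q (c + 1 : ℕ) (c + 1) := by
  have h4 : gaussNum q (c + 1 : ℕ) (c + 1) = ((q : ℂ) ^ (c + 1) - 1) * q ^ c * gaussNum q c c := by
    push_cast
    rw [gaussNum_succ_succ hq]
    norm_cast
  rw [gaussBinom_natCast, div_eq_div_iff (gaussNum_self_ne_zero hq c)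
    (gaussNum_self_ne_zero hq (c + 1)), h4]
  ring

/-- The `q`-Pascal rule `[a+1, b] = [a, b-1] + q^b [a, b]`. -/
theorem gaussBinom_succ_left {q : ℕ} (hq : 1 < q) (a b : ℤ) :
    gaussBinom q (a + 1) b = gaussBinom q a (b - 1) + (q : ℂ) ^ b * gaussBinom q a b := by
  have h0 : (q : ℂ) ≠ 0 := by exact_mod_cast (by omega : q ≠ 0)
  rcases lt_trichotomy b 0 with hb | rfl | hb
  · rw [gaussBinom_of_neg q _ hb, gaussBinom_of_neg q _ hb,
      gaussBinom_of_neg q _ (by omega : b - 1 < 0)]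
    simp
  · simp [gaussBinom_of_neg]
  · obtain ⟨c, rfl⟩ : ∃ c : ℕ, b = (c + 1 : ℕ) := ⟨(b - 1).toNat, by omega⟩
    have h1 : ((c + 1 : ℕ) : ℤ) - 1 = c := by push_cast; ring
    rw [h1, gaussBinom_eq_div_gaussNum_succ hq a c, gaussBinom_natCast, gaussBinom_natCast,
      gaussNum_succ_succ hq a, gaussNum_succ q a, zpow_natCast, zpow_add_one₀ h0]
    ring

/-- The `q`-Pascal rule `[a+1, b] = [a, b] + q^(a+1-b) [a, b-1]`. -/
theorem gaussBinom_succ_left' {q : ℕ} (hq : 1 < q) (a b : ℤ) :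
    gaussBinom q (a + 1) b =
      gaussBinom q a b + (q : ℂ) ^ (a + 1 - b) * gaussBinom q a (b - 1) := by
  have h0 : (q : ℂ) ≠ 0 := by exact_mod_cast (by omega : q ≠ 0)
  rcases lt_trichotomy b 0 with hb | rfl | hb
  · rw [gaussBinom_of_neg q _ hb, gaussBinom_of_neg q _ hb,
      gaussBinom_of_neg q _ (by omega : b - 1 < 0)]
    simp
  · simp [gaussBinom_of_neg]
  · obtain ⟨c, rfl⟩ : ∃ c : ℕ, b = (c + 1 : ℕ) := ⟨(b - 1).toNat, by omega⟩
    have h1 : ((c + 1 : ℕ) : ℤ) - 1 = c := by push_cast; ring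
    have h6 : (q : ℂ) ^ (a + 1 - (c + 1 : ℕ)) = q ^ a / q ^ c := by
      rw [show a + 1 - ((c + 1 : ℕ) : ℤ) = a - c by push_cast; ring, zpow_sub₀ h0, zpow_natCast]
    have h7 : (q : ℂ) ^ c ≠ 0 := pow_ne_zero _ h0
    rw [h1, gaussBinom_eq_div_gaussNum_succ hq a c, gaussBinom_natCast, gaussBinom_natCast,
      gaussNum_succ_succ hq a, gaussNum_succ q a, zpow_add_one₀ h0, h6]
    field_simp
    ring

/-- The unnormalized `q`-factorial `∏_{i < n} (q ^ (i + 1) - 1)`, that is, `(q - 1) ^ n` times the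
usual one. -/
def gaussFactorial (q n : ℕ) : ℂ := ∏ i ∈ Finset.range n, ((q : ℂ) ^ (i + 1) - 1)

theorem gaussFactorial_ne_zero {q : ℕ} (hq : 1 < q) (n : ℕ) : gaussFactorial q n ≠ 0 :=
  Finset.prod_ne_zero_iff.2 fun i _ ↦ natCast_pow_sub_one_ne_zero hq i

theorem gaussBinom_add_eq {q : ℕ} (hq : 1 < q) (a b : ℕ) :
    gaussBinom q ((a + b : ℕ) : ℤ) b =
      gaussFactorial q (a + b) / (gaussFactorial q a * gaussFactorial q b) := by
  have h0 : (q : ℂ) ≠ 0 := by exact_mod_cast (by omega : q ≠ 0)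
  have key : ∀ b : ℕ, gaussNum q ((a + b : ℕ) : ℤ) b * (gaussFactorial q a * gaussFactorial q b) =
      gaussFactorial q (a + b) * gaussNum q b b := by
    intro b
    induction b with
    | zero => simp [gaussNum, gaussFactorial]
    | succ b ih =>
      have e1 : gaussNum q ((a + (b + 1) : ℕ) : ℤ) (b + 1) =
          ((q : ℂ) ^ (a + b + 1) - 1) * q ^ b * gaussNum q ((a + b : ℕ) : ℤ) b := by
        rw [show ((a + (b + 1) : ℕ) : ℤ) = ((a + b : ℕ) : ℤ) + 1 by push_cast; ring,
          gaussNum_succ_succ hq]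
        norm_cast
      have e2 : gaussNum q ((b + 1 : ℕ) : ℤ) (b + 1) =
          ((q : ℂ) ^ (b + 1) - 1) * q ^ b * gaussNum q b b := by
        push_cast
        rw [gaussNum_succ_succ hq]
        norm_cast
      have e3 : ∀ n, gaussFactorial q (n + 1) = gaussFactorial q n * ((q : ℂ) ^ (n + 1) - 1) :=
        fun n ↦ Finset.prod_range_succ _ _
      rw [e1, e2, e3, ← add_assoc, e3]
      linear_combination ((q : ℂ) ^ (a + b + 1) - 1) * q ^ b * ((q : ℂ) ^ (b + 1) - 1) * ih
  rw [gaussBinom_natCast, div_eq_div_iff (gaussNum_self_ne_zero hq b)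
    (mul_ne_zero (gaussFactorial_ne_zero hq _) (gaussFactorial_ne_zero hq _)), key]

theorem gaussBinom_symm {q : ℕ} (hq : 1 < q) (a b : ℕ) :
    gaussBinom q ((a + b : ℕ) : ℤ) b = gaussBinom q ((a + b : ℕ) : ℤ) a := by
  rw [gaussBinom_add_eq hq]
  conv_rhs => rw [add_comm, gaussBinom_add_eq hq]
  rw [add_comm a b, mul_comm]

/-- Symmetry `[a, b] = [a, a - b]`, in the form with integer arguments. -/
theorem gaussBinom_symm_of_le {q : ℕ} (hq : 1 < q) {a b c : ℤ} (hb : 0 ≤ b) (hc : 0 ≤ c)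
    (h : a = b + c) : gaussBinom q a b = gaussBinom q a c := by
  lift b to ℕ using hb
  lift c to ℕ using hc
  subst h
  exact_mod_cast (gaussBinom_symm hq b c).symm

/-- Flags `t ≤ t + u` in dimension `t + u + v` can be counted from either end:
`[t+u+v, t] [u+v, v] = [t+u+v, v] [t+u, t]`. -/
theorem gaussBinom_mul_gaussBinom {q : ℕ} (hq : 1 < q) (t u v : ℕ) :
    gaussBinom q ((u + v + t : ℕ) : ℤ) t * gaussBinom q ((u + v : ℕ) : ℤ) v =
      gaussBinom q ((u + t + v : ℕ) : ℤ) v * gaussBinom q ((u + t : ℕ) : ℤ) t := by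
  rw [gaussBinom_add_eq hq, gaussBinom_add_eq hq, gaussBinom_add_eq hq, gaussBinom_add_eq hq,
    show u + v + t = u + t + v by ring]
  have h := gaussFactorial_ne_zero hq
  field_simp [h]

/-- The partial alternating sums of the `q`-binomial theorem telescope. -/
theorem sum_neg_one_pow_gaussBinom {q : ℕ} (hq : 1 < q) (e U : ℕ) :
    ∑ u ∈ Finset.range (U + 1),
      (-1 : ℂ) ^ u * (q : ℂ) ^ (u.choose 2) * gaussBinom q ((e + 1 : ℕ) : ℤ) u =
    (-1 : ℂ) ^ U * (q : ℂ) ^ ((U + 1).choose 2) * gaussBinom q e U := by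
  induction U with
  | zero => simp
  | succ U ih =>
    rw [Finset.sum_range_succ, ih]
    push_cast
    rw [gaussBinom_succ_left hq]
    have h1 : (U + 1 + 1).choose 2 = (U + 1) + (U + 1).choose 2 := by
      rw [Nat.choose_succ_succ' (U + 1) 1, Nat.choose_one_right]
    have h2 : (q : ℂ) ^ ((U : ℤ) + 1) = q ^ (U + 1) := by norm_cast
    rw [h1, h2, pow_add _ (U + 1), pow_succ (-1 : ℂ), add_sub_cancel_right]
    ring

theorem sum_neg_one_pow_gaussBinom_eq_zero {q : ℕ} (hq : 1 < q) {e : ℕ} (he : e ≠ 0) :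
    ∑ u ∈ Finset.range (e + 1), (-1 : ℂ) ^ u * (q : ℂ) ^ (u.choose 2) * gaussBinom q e u = 0 := by
  obtain ⟨e, rfl⟩ := Nat.exists_eq_succ_of_ne_zero he
  rw [Nat.succ_eq_add_one, sum_neg_one_pow_gaussBinom hq, gaussBinom_of_lt q (Nat.lt_succ_self e),
    mul_zero]

/-- Gaussian inversion: the matrices `[N-ρ, j-ρ]` and `(-1)^(s-j) q^(binom (s-j) 2) [N-j, N-s]`
are inverse to each other. -/
theorem sum_gaussBinom_inversion {q : ℕ} (hq : 1 < q) {N s ρ : ℕ} (hs : s ≤ N) (hρ : ρ ≤ N) :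
    ∑ j ∈ Finset.range (s + 1), (-1 : ℂ) ^ (s - j) * (q : ℂ) ^ ((s - j).choose 2) *
      gaussBinom q ((N : ℤ) - j) ((N : ℤ) - s) * gaussBinom q ((N : ℤ) - ρ) ((j : ℤ) - ρ) =
    if ρ = s then 1 else 0 := by
  rcases lt_or_ge s ρ with h | h
  · rw [if_neg h.ne']
    refine Finset.sum_eq_zero fun j hj ↦ ?_
    rw [gaussBinom_of_neg q _ (by have := Finset.mem_range.1 hj; omega : (j : ℤ) - ρ < 0), mul_zero]
  obtain ⟨e, rfl⟩ := Nat.exists_eq_add_of_le h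
  obtain ⟨v, rfl⟩ := Nat.exists_eq_add_of_le hs
  -- With `u = s - j` the terms become `[M, v] (-1)^u q^(binom u 2) [e, u]`, where `M = N - ρ`.
  rw [← Finset.sum_range_reflect]
  have hterm : ∀ u ∈ Finset.range (e + 1),
      (-1 : ℂ) ^ (ρ + e - (ρ + e + 1 - 1 - u)) *
        (q : ℂ) ^ ((ρ + e - (ρ + e + 1 - 1 - u)).choose 2) *
        gaussBinom q (((ρ + e + v : ℕ) : ℤ) - (ρ + e + 1 - 1 - u : ℕ))
          (((ρ + e + v : ℕ) : ℤ) - (ρ + e : ℕ)) *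
        gaussBinom q (((ρ + e + v : ℕ) : ℤ) - ρ) (((ρ + e + 1 - 1 - u : ℕ) : ℤ) - ρ) =
      gaussBinom q ((e + v : ℕ) : ℤ) v *
        ((-1 : ℂ) ^ u * (q : ℂ) ^ (u.choose 2) * gaussBinom q e u) := by
    intro u hu
    obtain ⟨t, rfl⟩ := Nat.exists_eq_add_of_le (Nat.lt_succ_iff.1 (Finset.mem_range.1 hu))
    have := gaussBinom_mul_gaussBinom hq t u v
    rw [gaussBinom_symm hq u t] at this
    rw [show ρ + (u + t) - (ρ + (u + t) + 1 - 1 - u) = u by omega,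
      show (((ρ + (u + t) + v : ℕ) : ℤ) - (ρ + (u + t) + 1 - 1 - u : ℕ)) = (u + v : ℕ) by omega,
      show (((ρ + (u + t) + v : ℕ) : ℤ) - (ρ + (u + t) : ℕ)) = v by omega,
      show (((ρ + (u + t) + v : ℕ) : ℤ) - ρ) = (u + v + t : ℕ) by omega,
      show (((ρ + (u + t) + 1 - 1 - u : ℕ) : ℤ) - ρ) = t by omega]
    linear_combination (-1 : ℂ) ^ u * (q : ℂ) ^ (u.choose 2) * this
  have hzero : ∀ u ∈ Finset.range (ρ + e + 1), u ∉ Finset.range (e + 1) →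
      (-1 : ℂ) ^ (ρ + e - (ρ + e + 1 - 1 - u)) *
        (q : ℂ) ^ ((ρ + e - (ρ + e + 1 - 1 - u)).choose 2) *
        gaussBinom q (((ρ + e + v : ℕ) : ℤ) - (ρ + e + 1 - 1 - u : ℕ))
          (((ρ + e + v : ℕ) : ℤ) - (ρ + e : ℕ)) *
        gaussBinom q (((ρ + e + v : ℕ) : ℤ) - ρ) (((ρ + e + 1 - 1 - u : ℕ) : ℤ) - ρ) = 0 := by
    intro u hu hu'
    rw [Finset.mem_range] at hu hu'
    rw [gaussBinom_of_neg q _ (by omega : ((ρ + e + 1 - 1 - u : ℕ) : ℤ) - ρ < 0), mul_zero]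
  rw [← Finset.sum_subset (Finset.range_subset_range.2 (by omega)) hzero,
    Finset.sum_congr rfl hterm, ← Finset.mul_sum]
  by_cases he : e = 0
  · subst he
    simp [gaussBinom_self hq]
  · rw [sum_neg_one_pow_gaussBinom_eq_zero hq he, mul_zero, if_neg (by omega)]

/-- The `q`-Vandermonde identity for integers `A` and `B`; the terms with `j > c` vanish, so any
range reaching `c` will do. -/
theorem gaussBinom_vandermonde {q : ℕ} (hq : 1 < q) (c : ℕ) : ∀ (A B : ℤ) (J : ℕ), c ≤ J →
    ∑ j ∈ Finset.range (J + 1), gaussBinom q c j * gaussBinom q A (B + j) *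
      (q : ℂ) ^ ((j : ℤ) * (B + j)) = gaussBinom q (A + c) (B + c) := by
  have h0 : (q : ℂ) ≠ 0 := by exact_mod_cast (by omega : q ≠ 0)
  induction c with
  | zero =>
    intro A B J _
    rw [Finset.sum_eq_single 0]
    · simp
    · intro j _ hj
      rw [gaussBinom_of_lt q (Nat.pos_of_ne_zero hj)]
      simp
    · simp
  | succ c ih =>
    intro A B J hJ
    -- Pascal's rule for `[c + 1, j]` gives the sums for `(c, A, B)` and, after shifting `j`, for
    -- `(c, A, B + 1)`; Pascal's rule for `[A + c + 1, B + c + 1]` joins them.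
    obtain ⟨J, rfl⟩ : ∃ J', J = J' + 1 := ⟨J - 1, by omega⟩
    have hsplit : ∀ j : ℕ, gaussBinom q ((c + 1 : ℕ) : ℤ) j * gaussBinom q A (B + j) *
        (q : ℂ) ^ ((j : ℤ) * (B + j)) =
        gaussBinom q c j * gaussBinom q A (B + j) * (q : ℂ) ^ ((j : ℤ) * (B + j)) +
        (q : ℂ) ^ ((c : ℤ) + 1 - j) * gaussBinom q c ((j : ℤ) - 1) * gaussBinom q A (B + j) *
          (q : ℂ) ^ ((j : ℤ) * (B + j)) := by
      intro j
      push_cast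
      rw [gaussBinom_succ_left' hq]
      ring
    simp_rw [hsplit]
    rw [Finset.sum_add_distrib, ih A B (J + 1) (by omega), Finset.sum_range_succ']
    have hshift : ∀ j ∈ Finset.range (J + 1),
        (q : ℂ) ^ ((c : ℤ) + 1 - (j + 1 : ℕ)) * gaussBinom q c (((j + 1 : ℕ) : ℤ) - 1) *
          gaussBinom q A (B + (j + 1 : ℕ)) * (q : ℂ) ^ (((j + 1 : ℕ) : ℤ) * (B + (j + 1 : ℕ))) =
        (q : ℂ) ^ (B + 1 + c) * (gaussBinom q c j * gaussBinom q A ((B + 1) + j) *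
          (q : ℂ) ^ ((j : ℤ) * ((B + 1) + j))) := by
      intro j _
      have e : (q : ℂ) ^ ((c : ℤ) + 1 - (j + 1 : ℕ)) *
          (q : ℂ) ^ (((j + 1 : ℕ) : ℤ) * (B + (j + 1 : ℕ))) =
          (q : ℂ) ^ (B + 1 + c) * (q : ℂ) ^ ((j : ℤ) * ((B + 1) + j)) := by
        rw [← zpow_add₀ h0, ← zpow_add₀ h0]
        congr 1
        push_cast
        ring
      rw [show ((j + 1 : ℕ) : ℤ) - 1 = j by push_cast; ring,
        show B + ((j + 1 : ℕ) : ℤ) = B + 1 + j by push_cast; ring] at *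
      linear_combination gaussBinom q c j * gaussBinom q A (B + 1 + j) * e
    rw [Finset.sum_congr rfl hshift, ← Finset.mul_sum, ih A (B + 1) J (by omega)]
    push_cast
    rw [← add_assoc, ← add_assoc, gaussBinom_succ_left hq,
      gaussBinom_of_neg q c (by norm_num : (-1 : ℤ) < 0),
      show B + ((c : ℤ) + 1) - 1 = B + c by ring, show B + 1 + (c : ℤ) = B + (c + 1) by ring]
    ring

/-! ### Counting subspaces -/

section Dimension

variable {F V : Type*} [Field F] [AddCommGroup V] [Module F V]

theorem map_subtype_submoduleOf {T U : Submodule F V} (hTU : T ≤ U) :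
    (T.submoduleOf U).map U.subtype = T :=
  (Submodule.map_comap_subtype U T).trans (inf_eq_right.2 hTU)

theorem submoduleOf_map_subtype {U : Submodule F V} (X : Submodule F U) :
    (X.map U.subtype).submoduleOf U = X :=
  Submodule.comap_map_eq_of_injective U.injective_subtype X

theorem finrank_comap_mkQ [FiniteDimensional F V] (T : Submodule F V) (w : Submodule F (V ⧸ T)) :
    finrank F (w.comap T.mkQ) = finrank F w + finrank F T := by
  have h := (T.mkQ.domRestrict (w.comap T.mkQ)).finrank_range_add_finrank_ker
  rw [LinearMap.range_domRestrict, Submodule.map_comap_eq_of_surjective T.mkQ_surjective,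
    LinearMap.ker_domRestrict, Submodule.ker_mkQ] at h
  rw [← h, ← (Submodule.submoduleOfEquivOfLe (Submodule.le_comap_mkQ T w)).finrank_eq]
  rfl

end Dimension

section Counting

variable {F V : Type*} [Field F] [Finite F] [AddCommGroup V] [Module F V] [FiniteDimensional F V]

instance instFintypeSubmodule : Fintype (Submodule F V) :=
  haveI : Finite V := Module.finite_of_finite F
  haveI : Finite (Submodule F V) := Finite.of_injective _ SetLike.coe_injective
  Fintype.ofFinite _

/-- The linearly independent `b`-tuples in `V` spanning a given `b`-dimensional subspace `U` are
the linearly independent `b`-tuples in `U`. -/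
def linearIndependentSpanEquiv {b : ℕ} (U : Submodule F V) (hU : finrank F U = b) :
    {v : {v : Fin b → V // LinearIndependent F v} // Submodule.span F (Set.range v.1) = U} ≃
      {v : Fin b → U // LinearIndependent F v} where
  toFun v := ⟨fun i ↦ ⟨v.1.1 i, v.2.le (Submodule.subset_span ⟨i, rfl⟩)⟩,
    LinearIndependent.of_comp U.subtype v.1.2⟩
  invFun v := ⟨⟨fun i ↦ v.1 i, v.2.map' U.subtype U.ker_subtype⟩, by
    have h := v.2.span_eq_top_of_card_eq_finrank' (by simp [hU])
    have h2 : Set.range (fun i ↦ (v.1 i : V)) = U.subtype '' Set.range v.1 := by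
      rw [← Set.range_comp]; rfl
    rw [h2, Submodule.span_image, h, Submodule.map_subtype_top]⟩
  left_inv _ := rfl
  right_inv _ := rfl

theorem natCast_card_linearIndependent {b : ℕ} (hb : b ≤ finrank F V) :
    (Nat.card {v : Fin b → V // LinearIndependent F v} : ℂ) =
      gaussNum (Nat.card F) (finrank F V) b := by
  have : Finite V := Module.finite_of_finite F
  have := Fintype.ofFinite F
  have := Fintype.ofFinite V
  rw [card_linearIndependent hb, gaussNum, Nat.cast_prod,
    Finset.prod_range fun i ↦ ((Nat.card F : ℂ) ^ (finrank F V : ℤ) - (Nat.card F : ℂ) ^ i)]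
  refine Finset.prod_congr rfl fun i _ ↦ ?_
  rw [Nat.cast_sub (Nat.pow_le_pow_right Fintype.card_pos (by omega))]
  simp

/-- The number of `b`-dimensional subspaces is a Gaussian coefficient. -/
theorem natCard_finrank_eq (b : ℕ) :
    (Nat.card {U : Submodule F V // finrank F U = b} : ℂ) =
      gaussBinom (Nat.card F) (finrank F V) b := by
  have : Finite V := Module.finite_of_finite F
  rcases lt_or_ge (finrank F V) b with hb | hb
  · have : IsEmpty {U : Submodule F V // finrank F U = b} :=
      ⟨fun U ↦ by have := U.1.finrank_le; have := U.2; omega⟩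
    rw [gaussBinom_of_lt _ hb, Nat.card_of_isEmpty, Nat.cast_zero]
  let f : {v : Fin b → V // LinearIndependent F v} → {U : Submodule F V // finrank F U = b} :=
    fun v ↦ ⟨Submodule.span F (Set.range v.1), by simpa using finrank_span_eq_card v.2⟩
  have h1 : Nat.card {v : Fin b → V // LinearIndependent F v} =
      ∑ U : {U : Submodule F V // finrank F U = b},
        Nat.card {v : Fin b → U.1 // LinearIndependent F v} := by
    rw [Nat.card_congr (Equiv.sigmaFiberEquiv f).symm, Nat.card_sigma]
    refine Finset.sum_congr rfl fun U _ ↦ Nat.card_congr ?_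
    exact (Equiv.subtypeEquivRight fun v ↦ Subtype.ext_iff).trans
      (linearIndependentSpanEquiv U.1 U.2)
  have h2 : ∀ U : {U : Submodule F V // finrank F U = b},
      (Nat.card {v : Fin b → U.1 // LinearIndependent F v} : ℂ) = gaussNum (Nat.card F) b b := by
    intro U
    rw [natCast_card_linearIndependent U.2.ge, U.2]
  have h3 := congrArg (Nat.cast : ℕ → ℂ) h1
  rw [natCast_card_linearIndependent hb, Nat.cast_sum, Finset.sum_congr rfl fun U _ ↦ h2 U,
    Finset.sum_const, Finset.card_univ, nsmul_eq_mul, ← Nat.card_eq_fintype_card] at h3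
  rw [gaussBinom_natCast, h3, mul_div_cancel_right₀ _ (gaussNum_self_ne_zero Finite.one_lt_card b)]

/-- The subspaces between `T` and `U` are the subspaces of `U / T`. -/
def intervalEquiv {T U : Submodule F V} (hTU : T ≤ U) (b : ℕ) :
    {w : Submodule F (U ⧸ T.submoduleOf U) // finrank F w = b} ≃
      {w : Submodule F V // T ≤ w ∧ w ≤ U ∧ finrank F w = b + finrank F T} where
  toFun w := ⟨(w.1.comap (T.submoduleOf U).mkQ).map U.subtype, by
      have h := Submodule.map_mono (f := U.subtype)
        (Submodule.le_comap_mkQ (T.submoduleOf U) w.1)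
      rwa [map_subtype_submoduleOf hTU] at h,
    Submodule.map_subtype_le _ _, by
      rw [Submodule.finrank_map_subtype_eq, finrank_comap_mkQ, w.2,
        (Submodule.submoduleOfEquivOfLe hTU).finrank_eq]⟩
  invFun w := ⟨(w.1.submoduleOf U).map (T.submoduleOf U).mkQ, by
    have h := finrank_comap_mkQ _ ((w.1.submoduleOf U).map (T.submoduleOf U).mkQ)
    rw [Submodule.comap_map_mkQ, sup_eq_right.2 (Submodule.comap_mono w.2.1),
      (Submodule.submoduleOfEquivOfLe hTU).finrank_eq,
      (Submodule.submoduleOfEquivOfLe w.2.2.1).finrank_eq, w.2.2.2] at h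
    omega⟩
  left_inv w := Subtype.ext <| by
    dsimp only
    rw [submoduleOf_map_subtype,
      Submodule.map_comap_eq_of_surjective (Submodule.mkQ_surjective _)]
  right_inv w := Subtype.ext <| by
    dsimp only
    rw [Submodule.comap_map_mkQ, sup_eq_right.2 (Submodule.comap_mono w.2.1),
      map_subtype_submoduleOf w.2.2.1]

open Classical in
/-- The number of `r`-dimensional subspaces `w` with `T ≤ w ≤ U`, as a complex number. -/
def intervalCount (T U : Submodule F V) (r : ℕ) : ℂ :=
  ∑ w : Submodule F V, if T ≤ w ∧ w ≤ U ∧ finrank F w = r then 1 else 0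

theorem intervalCount_of_not_le {T U : Submodule F V} (h : ¬ T ≤ U) (r : ℕ) :
    intervalCount T U r = 0 :=
  Finset.sum_eq_zero fun _ _ ↦ if_neg fun hw ↦ h (hw.1.trans hw.2.1)

theorem intervalCount_eq {T U : Submodule F V} (hTU : T ≤ U) (r : ℕ) :
    intervalCount T U r =
      gaussBinom (Nat.card F) ((finrank F U : ℤ) - finrank F T) ((r : ℤ) - finrank F T) := by
  classical
  rcases lt_or_ge r (finrank F T) with hr | hr
  · rw [gaussBinom_of_neg _ _ (by omega)]
    refine Finset.sum_eq_zero fun w _ ↦ if_neg fun hw ↦ ?_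
    have := Submodule.finrank_mono hw.1
    omega
  obtain ⟨b, rfl⟩ := Nat.exists_eq_add_of_le' hr
  have h := natCard_finrank_eq (F := F) (V := U ⧸ T.submoduleOf U) b
  have hdim := (T.submoduleOf U).finrank_quotient_add_finrank
  rw [(Submodule.submoduleOfEquivOfLe hTU).finrank_eq] at hdim
  rw [Nat.card_congr (intervalEquiv hTU b), Nat.card_eq_fintype_card, Fintype.card_subtype,
    Finset.natCast_card_filter] at h
  rw [intervalCount, h]
  congr 1 <;> omega

end Counting

/-! ### The product rule in the Grassmann scheme -/

section Grassmann

variable {F V : Type*} [Field F] [Finite F] [AddCommGroup V] [Module F V] [FiniteDimensional F V]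

open Classical in
/-- Pairs `(u, u')` in `[T, x] × [T, y]` together with `w` in `[T, u ⊓ u']`, counted by first
choosing `w` in `[T, x ⊓ y]`. -/
theorem sum_intervalCount_inf (T x y : Submodule F V) (r k i : ℕ) :
    ∑ u : Submodule F V, ∑ u' : Submodule F V,
      (if T ≤ u ∧ u ≤ x ∧ finrank F u = r then (1 : ℂ) else 0) *
        (if T ≤ u' ∧ u' ≤ y ∧ finrank F u' = k then 1 else 0) * intervalCount T (u ⊓ u') i =
    ∑ w : Submodule F V, if T ≤ w ∧ w ≤ x ⊓ y ∧ finrank F w = i then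
      intervalCount w x r * intervalCount w y k else 0 := by
  simp_rw [intervalCount, Finset.mul_sum, Finset.sum_mul]
  have h1 : ∀ u u' w : Submodule F V,
      (if T ≤ u ∧ u ≤ x ∧ finrank F u = r then (1 : ℂ) else 0) *
        (if T ≤ u' ∧ u' ≤ y ∧ finrank F u' = k then 1 else 0) *
        (if T ≤ w ∧ w ≤ u ⊓ u' ∧ finrank F w = i then 1 else 0) =
      (if T ≤ w ∧ w ≤ x ⊓ y ∧ finrank F w = i then
        (if w ≤ u ∧ u ≤ x ∧ finrank F u = r then (1 : ℂ) else 0) *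
        (if w ≤ u' ∧ u' ≤ y ∧ finrank F u' = k then 1 else 0) else 0) := by
    intro u u' w
    rw [ite_zero_mul_ite_zero, ite_zero_mul_ite_zero, ite_zero_mul_ite_zero, ← ite_and]
    simp only [mul_one]
    refine if_congr ⟨?_, ?_⟩ rfl rfl
    · rintro ⟨⟨⟨-, h1, h2⟩, -, h3, h4⟩, h5, h6, h7⟩
      rw [le_inf_iff] at h6
      exact ⟨⟨h5, le_inf (h6.1.trans h1) (h6.2.trans h3), h7⟩, ⟨h6.1, h1, h2⟩, h6.2, h3, h4⟩
    · rintro ⟨⟨h5, -, h7⟩, ⟨h8, h1, h2⟩, h9, h3, h4⟩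
      exact ⟨⟨⟨h5.trans h8, h1, h2⟩, h5.trans h9, h3, h4⟩, h5, le_inf h8 h9, h7⟩
  have h2 : ∀ w : Submodule F V, (if T ≤ w ∧ w ≤ x ⊓ y ∧ finrank F w = i then
      ∑ u' : Submodule F V, ∑ u : Submodule F V,
        (if w ≤ u ∧ u ≤ x ∧ finrank F u = r then (1 : ℂ) else 0) *
        (if w ≤ u' ∧ u' ≤ y ∧ finrank F u' = k then 1 else 0) else 0) =
      ∑ u' : Submodule F V, ∑ u : Submodule F V,
      (if T ≤ w ∧ w ≤ x ⊓ y ∧ finrank F w = i then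
        (if w ≤ u ∧ u ≤ x ∧ finrank F u = r then (1 : ℂ) else 0) *
        (if w ≤ u' ∧ u' ≤ y ∧ finrank F u' = k then 1 else 0) else 0) := by
    intro w
    split_ifs <;> simp
  simp_rw [h1, h2]
  rw [Finset.sum_comm, Finset.sum_congr rfl fun u' _ ↦ Finset.sum_comm, Finset.sum_comm]

/-- The product rule in the Grassmann scheme, relative to a fixed subspace `T`. -/
theorem sum_intervalCount_mul_intervalCount {T x y : Submodule F V} {m r k : ℕ}
    (hx : finrank F x = m) (hy : finrank F y = m) (hr : r ≤ m) (hk : k ≤ m) :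
    ∑ z : {z : Submodule F V // finrank F z = m},
      intervalCount T (x ⊓ z.1) r * intervalCount T (z.1 ⊓ y) k =
    ∑ i ∈ Finset.Icc (finrank F T) (min r k),
      (Nat.card F : ℂ) ^ (((i : ℤ) - finrank F T) * ((m : ℤ) - r - k + i)) *
        gaussBinom (Nat.card F) ((m : ℤ) - i) ((m : ℤ) - r) *
        gaussBinom (Nat.card F) ((m : ℤ) - i) ((m : ℤ) - k) *
        gaussBinom (Nat.card F) ((finrank F V : ℤ) - r - k + finrank F T) ((m : ℤ) - r - k + i) *
        intervalCount T (x ⊓ y) i := by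
  classical
  set q := Nat.card F with hq
  have hq1 : 1 < q := Finite.one_lt_card
  set s := finrank F T with hs
  set n := finrank F V with hn
  let a : Submodule F V → ℂ := fun u ↦ if T ≤ u ∧ u ≤ x ∧ finrank F u = r then 1 else 0
  let b : Submodule F V → ℂ := fun u ↦ if T ≤ u ∧ u ≤ y ∧ finrank F u = k then 1 else 0
  let coef : ℕ → ℂ := fun i ↦ (q : ℂ) ^ (((i : ℤ) - s) * ((m : ℤ) - r - k + i)) *
    gaussBinom q ((n : ℤ) - r - k + s) ((m : ℤ) - r - k + i)
  -- Choose `u ≤ x ⊓ z` and `u' ≤ z ⊓ y` first, and then `z` containing `u ⊔ u'`.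
  have h1 : ∑ z : {z : Submodule F V // finrank F z = m},
      intervalCount T (x ⊓ z.1) r * intervalCount T (z.1 ⊓ y) k =
      ∑ u : Submodule F V, ∑ u' : Submodule F V, a u * b u' * intervalCount (u ⊔ u') ⊤ m := by
    have h2 : ∀ z u u' : Submodule F V, finrank F z = m →
        (if T ≤ u ∧ u ≤ x ⊓ z ∧ finrank F u = r then (1 : ℂ) else 0) *
          (if T ≤ u' ∧ u' ≤ z ⊓ y ∧ finrank F u' = k then 1 else 0) =
        a u * b u' * if u ⊔ u' ≤ z ∧ z ≤ ⊤ ∧ finrank F z = m then 1 else 0 := by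
      intro z u u' hz
      simp only [a, b]
      rw [ite_zero_mul_ite_zero, ite_zero_mul_ite_zero, ite_zero_mul_ite_zero]
      simp only [mul_one]
      refine if_congr ?_ rfl rfl
      simp only [le_inf_iff, sup_le_iff, le_top, hz]
      tauto
    simp_rw [intervalCount, Finset.sum_mul_sum, Finset.mul_sum]
    rw [Finset.sum_congr rfl fun z _ ↦ Finset.sum_congr rfl fun u _ ↦
      Finset.sum_congr rfl fun u' _ ↦ h2 z.1 u u' z.2]
    rw [Finset.sum_comm]
    refine Finset.sum_congr rfl fun u _ ↦ ?_
    rw [Finset.sum_comm]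
    refine Finset.sum_congr rfl fun u' _ ↦ ?_
    rw [← Finset.sum_subtype (Finset.univ.filter fun z : Submodule F V ↦ finrank F z = m) (by simp)
      (fun z ↦ a u * b u' * if u ⊔ u' ≤ z ∧ z ≤ ⊤ ∧ finrank F z = m then 1 else 0),
      Finset.sum_filter]
    refine Finset.sum_congr rfl fun z _ ↦ ?_
    by_cases hz : finrank F z = m <;> simp [hz]
  -- The `q`-Vandermonde identity expresses the count of `z` through subspaces of `u ⊓ u'`.
  have h3 : ∀ u u' : Submodule F V, a u * b u' * intervalCount (u ⊔ u') ⊤ m =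
      ∑ i ∈ Finset.Icc s (min r k), coef i * (a u * b u' * intervalCount T (u ⊓ u') i) := by
    intro u u'
    by_cases hu : T ≤ u ∧ u ≤ x ∧ finrank F u = r
    swap
    · simp [a, hu]
    by_cases hu' : T ≤ u' ∧ u' ≤ y ∧ finrank F u' = k
    swap
    · simp [b, hu']
    have hT : T ≤ u ⊓ u' := le_inf hu.1 hu'.1
    obtain ⟨c, hc⟩ := Nat.exists_eq_add_of_le (Submodule.finrank_mono hT)
    have hdim := Submodule.finrank_sup_add_finrank_inf_eq u u'
    have hcr := Submodule.finrank_mono (inf_le_left : u ⊓ u' ≤ u)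
    have hck := Submodule.finrank_mono (inf_le_right : u ⊓ u' ≤ u')
    rw [hu.2.2, hu'.2.2] at hdim
    rw [hu.2.2] at hcr
    rw [hu'.2.2] at hck
    obtain ⟨J, hJ⟩ : ∃ J, min r k = s + J := Nat.exists_eq_add_of_le (by omega)
    have hv := gaussBinom_vandermonde hq1 c ((n : ℤ) - r - k + s) ((m : ℤ) - r - k + s) J
      (by omega)
    simp only [a, b, if_pos hu, if_pos hu', one_mul]
    rw [intervalCount_eq le_top, finrank_top, ← hn, ← hq, hJ,
      show (n : ℤ) - finrank F (u ⊔ u' : Submodule F V) = (n : ℤ) - r - k + s + c by omega,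
      show (m : ℤ) - finrank F (u ⊔ u' : Submodule F V) = (m : ℤ) - r - k + s + c by omega,
      ← hv, Finset.range_eq_Ico, ← Finset.Ico_add_one_right_eq_Icc,
      show s + J + 1 = (J + 1) + s by ring]
    refine Eq.trans ?_ ((Finset.sum_Ico_add' _ 0 (J + 1) s).trans (by rw [zero_add]))
    refine Finset.sum_congr rfl fun j _ ↦ ?_
    rw [intervalCount_eq hT, hc]
    simp only [coef, ← hs, ← hq]
    push_cast
    rw [show (j : ℤ) + s - s = j by ring, show (s : ℤ) + c - s = c by ring,
      show (m : ℤ) - r - k + (j + s) = (m : ℤ) - r - k + s + j by ring]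
    ring
  rw [h1, Finset.sum_congr rfl fun u _ ↦ Finset.sum_congr rfl fun u' _ ↦ h3 u u',
    Finset.sum_congr rfl fun u _ ↦ Finset.sum_comm, Finset.sum_comm]
  refine Finset.sum_congr rfl fun i hi ↦ ?_
  rw [Finset.mem_Icc, le_min_iff] at hi
  simp_rw [← Finset.mul_sum]
  have h4 := sum_intervalCount_inf T x y r k i
  simp only [a, b]
  rw [h4]
  have h5 : ∀ w : Submodule F V, (if T ≤ w ∧ w ≤ x ⊓ y ∧ finrank F w = i then
      intervalCount w x r * intervalCount w y k else 0) =
      gaussBinom q ((m : ℤ) - i) ((m : ℤ) - r) * gaussBinom q ((m : ℤ) - i) ((m : ℤ) - k) *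
        if T ≤ w ∧ w ≤ x ⊓ y ∧ finrank F w = i then 1 else 0 := by
    intro w
    split_ifs with hw
    · obtain ⟨hwx, hwy⟩ := le_inf_iff.1 hw.2.1
      rw [intervalCount_eq hwx, intervalCount_eq hwy, hw.2.2, hx, hy, ← hq, mul_one,
        gaussBinom_symm_of_le hq1 (a := (m : ℤ) - i) (b := (r : ℤ) - i) (c := (m : ℤ) - r),
        gaussBinom_symm_of_le hq1 (a := (m : ℤ) - i) (b := (k : ℤ) - i) (c := (m : ℤ) - k)] <;>
      omega
    · simp
  rw [Finset.sum_congr rfl fun w _ ↦ h5 w, ← Finset.mul_sum, intervalCount]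
  simp only [coef]
  ring

end Grassmann

/-! ### Character sums over linear maps -/

section Characters

variable {F : Type*} [Field F] [Finite F]

instance instFintypeLinearMap {X Y : Type*} [AddCommGroup X] [Module F X] [AddCommGroup Y]
    [Module F Y] [FiniteDimensional F X] [FiniteDimensional F Y] : Fintype (X →ₗ[F] Y) :=
  haveI : Finite X := Module.finite_of_finite F
  haveI : Finite Y := Module.finite_of_finite F
  haveI : Finite (X →ₗ[F] Y) := Finite.of_injective _ DFunLike.coe_injective
  Fintype.ofFinite _

open Classical in
/-- Orthogonality of characters for the trace pairing of `X → Y` with `Y → X`. -/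
theorem sum_addChar_trace_comp {X Y : Type*} [AddCommGroup X] [Module F X] [AddCommGroup Y]
    [Module F Y] [FiniteDimensional F X] [FiniteDimensional F Y] {ψ : AddChar F ℂ} (hψ : ψ ≠ 1)
    (σ : X →ₗ[F] Y) :
    ∑ τ : Y →ₗ[F] X, ψ (LinearMap.trace F Y (σ ∘ₗ τ)) =
      if σ = 0 then (Nat.card F : ℂ) ^ (finrank F X * finrank F Y) else 0 := by
  let T : (Y →ₗ[F] X) →+ F := (LinearMap.trace F Y ∘ₗ LinearMap.llcomp F Y X Y σ).toAddMonoidHom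
  have h := AddChar.sum_eq_ite (ψ.compAddMonoidHom T)
  have hcard : (Fintype.card (Y →ₗ[F] X) : ℂ) = (Nat.card F : ℂ) ^ (finrank F X * finrank F Y) := by
    rw [← Nat.card_eq_fintype_card, Module.natCard_eq_pow_finrank (K := F), Module.finrank_linearMap,
      mul_comm, Nat.cast_pow]
  rw [hcard] at h
  refine Eq.trans (Finset.sum_congr rfl fun τ _ ↦ rfl) (h.trans (if_congr ?_ rfl rfl))
  refine ⟨fun h0 ↦ ?_, ?_⟩
  · by_contra hσ
    obtain ⟨x, hx⟩ : ∃ x, σ x ≠ 0 := by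
      by_contra! hx
      exact hσ (LinearMap.ext hx)
    obtain ⟨f, hf⟩ := Module.Projective.exists_dual_eq_one F hx
    obtain ⟨c, hc⟩ := AddChar.ne_one_iff.1 hψ
    apply hc
    have h1 := DFunLike.congr_fun h0 (f.smulRight (c • x))
    have h2 : σ ∘ₗ f.smulRight (c • x) = f.smulRight (c • σ x) := by
      ext y; simp
    have h3 : LinearMap.trace F Y (σ ∘ₗ f.smulRight (c • x)) = c := by
      rw [h2, LinearMap.trace_smulRight, map_smul, hf, smul_eq_mul, mul_one]
    rw [← h3]
    exact h1
  · rintro rfl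
    ext τ
    simp [T]

variable {W E : Type*} [AddCommGroup W] [Module F W] [FiniteDimensional F W]
  [AddCommGroup E] [Module F E] [FiniteDimensional F E]

open Classical in
/-- A sum over the maps `E → W` with range in `U` is a sum over the maps `E → U`. -/
theorem sum_range_le (U : Submodule F W) (f : (E →ₗ[F] W) → ℂ) :
    ∑ τ : E →ₗ[F] W, (if LinearMap.range τ ≤ U then f τ else 0) =
      ∑ τ : E →ₗ[F] U, f (U.subtype ∘ₗ τ) := by
  rw [← Finset.sum_filter]
  refine Finset.sum_bij' (fun τ hτ ↦ τ.codRestrict U fun e ↦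
    (Finset.mem_filter.1 hτ).2 (LinearMap.mem_range_self τ e)) (fun τ _ ↦ U.subtype ∘ₗ τ)
    (fun _ _ ↦ Finset.mem_univ _) ?_ (fun _ _ ↦ rfl) (fun _ _ ↦ rfl) (fun _ _ ↦ rfl)
  intro τ _
  simpa using (LinearMap.range_comp_le_range τ U.subtype).trans_eq U.range_subtype

/-- Both sides sum `ψ (tr (σ τ))` over all `τ : E → W` together with a `j`-dimensional subspace
containing the range of `τ`. -/
theorem sum_addChar_trace_mul_gaussBinom {ψ : AddChar F ℂ} (hψ : ψ ≠ 1) (σ : W →ₗ[F] E) (j : ℕ) :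
    ∑ τ : E →ₗ[F] W, ψ (LinearMap.trace F E (σ ∘ₗ τ)) *
      gaussBinom (Nat.card F) ((finrank F W : ℤ) - finrank F (LinearMap.range τ))
        ((j : ℤ) - finrank F (LinearMap.range τ)) =
    (Nat.card F : ℂ) ^ (j * finrank F E) *
      gaussBinom (Nat.card F) ((finrank F W : ℤ) - finrank F (LinearMap.range σ)) j := by
  classical
  have h1 : ∀ τ : E →ₗ[F] W, gaussBinom (Nat.card F)
      ((finrank F W : ℤ) - finrank F (LinearMap.range τ))
        ((j : ℤ) - finrank F (LinearMap.range τ)) = intervalCount (LinearMap.range τ) ⊤ j := by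
    intro τ
    rw [intervalCount_eq le_top, finrank_top]
  have h2 : gaussBinom (Nat.card F) ((finrank F W : ℤ) - finrank F (LinearMap.range σ)) j =
      intervalCount ⊥ (LinearMap.ker σ) j := by
    have := σ.finrank_range_add_finrank_ker
    rw [intervalCount_eq bot_le, finrank_bot]
    congr 1
    omega
  simp_rw [h1, h2, intervalCount, Finset.mul_sum]
  rw [Finset.sum_comm]
  refine Finset.sum_congr rfl fun U _ ↦ ?_
  by_cases hU : finrank F U = j
  swap
  · simp [hU]
  have h3 : σ ∘ₗ U.subtype = 0 ↔ U ≤ LinearMap.ker σ := by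
    rw [← LinearMap.range_le_ker_iff, U.range_subtype]
  have h4 := sum_range_le U (fun τ : E →ₗ[F] W ↦ ψ (LinearMap.trace F E (σ ∘ₗ τ)))
  simp_rw [← LinearMap.comp_assoc] at h4
  rw [sum_addChar_trace_comp hψ] at h4
  simp only [hU, le_top, and_true, true_and, bot_le, mul_ite, mul_one, mul_zero]
  rw [h4]
  simp only [h3, hU]

open Classical in
/-- The generalized Krawtchouk polynomial is the sum of the characters `ψ (tr (σ τ))` over the maps
`τ` of rank `s`, where `σ` is any map of rank `x`. -/
theorem sum_addChar_trace_eq_krawtchouk {ψ : AddChar F ℂ} (hψ : ψ ≠ 1) (σ : W →ₗ[F] E) {s : ℕ}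
    (hs : s ≤ finrank F W) :
    ∑ τ : E →ₗ[F] W, (if finrank F (LinearMap.range τ) = s then
      ψ (LinearMap.trace F E (σ ∘ₗ τ)) else 0) =
    krawtchouk (Nat.card F) s (finrank F W) (finrank F E) (finrank F (LinearMap.range σ)) := by
  have h1 : ∀ j : ℕ, (-1 : ℂ) ^ (s - j) *
      (Nat.card F : ℂ) ^ (j * finrank F E + (s - j).choose 2) *
      gaussBinom (Nat.card F) ((finrank F W : ℤ) - j) ((finrank F W : ℤ) - s) *
      gaussBinom (Nat.card F) ((finrank F W : ℤ) - finrank F (LinearMap.range σ)) j =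
      ∑ τ : E →ₗ[F] W, ψ (LinearMap.trace F E (σ ∘ₗ τ)) *
        ((-1 : ℂ) ^ (s - j) * (Nat.card F : ℂ) ^ ((s - j).choose 2) *
        gaussBinom (Nat.card F) ((finrank F W : ℤ) - j) ((finrank F W : ℤ) - s) *
        gaussBinom (Nat.card F) ((finrank F W : ℤ) - finrank F (LinearMap.range τ))
        ((j : ℤ) - finrank F (LinearMap.range τ))) := by
    intro j
    have h2 := sum_addChar_trace_mul_gaussBinom hψ σ j
    rw [pow_add]
    calc _ = (-1 : ℂ) ^ (s - j) * (Nat.card F : ℂ) ^ ((s - j).choose 2) *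
        gaussBinom (Nat.card F) ((finrank F W : ℤ) - j) ((finrank F W : ℤ) - s) *
        ((Nat.card F : ℂ) ^ (j * finrank F E) *
        gaussBinom (Nat.card F) ((finrank F W : ℤ) - finrank F (LinearMap.range σ)) j) := by ring
      _ = _ := by
        rw [← h2, Finset.mul_sum]
        exact Finset.sum_congr rfl fun τ _ ↦ by ring
  rw [krawtchouk, Finset.sum_congr rfl fun j _ ↦ h1 j, Finset.sum_comm]
  refine Finset.sum_congr rfl fun τ _ ↦ ?_
  rw [← Finset.mul_sum, sum_gaussBinom_inversion Finite.one_lt_card hs (Submodule.finrank_le _),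
    mul_ite, mul_one, mul_zero]

end Characters

/-! ### The matrices `C_(r,s)` -/

section Phase

variable {F V E : Type*} [Field F] [AddCommGroup V] [Module F V] [AddCommGroup E] [Module F E]

/-- An extension of the second component `ξ : x → E` of the pair `(x, ξ)` to all of `V`. The choice
does not matter where it is used, since only its restriction to `x` enters. -/
def extension {m : ℕ} (p : Pairs F V E m) : V →ₗ[F] E :=
  (LinearMap.exists_extend p.2).choose

theorem extension_comp_subtype {m : ℕ} (p : Pairs F V E m) :
    extension p ∘ₗ p.1.1.subtype = p.2 :=
  (LinearMap.exists_extend p.2).choose_spec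

open Classical in
/-- The function on pairs attached to `τ : E → V`: its value at `(x, ξ)` is `ψ (tr (ξ τ))` if the
range of `τ` lies in `x`, and `0` otherwise. -/
def phase (ψ : AddChar F ℂ) {m : ℕ} (p : Pairs F V E m) (τ : E →ₗ[F] V) : ℂ :=
  if LinearMap.range τ ≤ p.1.1 then ψ (LinearMap.trace F E (extension p ∘ₗ τ)) else 0

theorem finrank_range_subtype_comp (U : Submodule F V) (τ : E →ₗ[F] U) :
    finrank F (LinearMap.range (U.subtype ∘ₗ τ)) = finrank F (LinearMap.range τ) := by
  rw [LinearMap.range_comp, Submodule.finrank_map_subtype_eq]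

theorem restrictDiff_eq {m : ℕ} (p p' : Pairs F V E m) :
    restrictDiff p p' = (extension p - extension p') ∘ₗ (p.1.1 ⊓ p'.1.1).subtype := by
  ext v
  have h1 := LinearMap.congr_fun (extension_comp_subtype p) ⟨v.1, v.2.1⟩
  have h2 := LinearMap.congr_fun (extension_comp_subtype p') ⟨v.1, v.2.2⟩
  simp only [restrictDiff, LinearMap.sub_apply, LinearMap.comp_apply, Submodule.subtype_apply]
    at h1 h2 ⊢
  rw [h1, h2]
  rfl

theorem phase_mul_phase_inv (ψ : AddChar F ℂ) {m : ℕ} (p p' : Pairs F V E m) (τ : E →ₗ[F] V)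
    (hτ : LinearMap.range τ ≤ p.1.1 ⊓ p'.1.1) :
    phase ψ p τ * phase ψ⁻¹ p' τ =
      ψ (LinearMap.trace F E ((extension p - extension p') ∘ₗ τ)) := by
  rw [phase, phase, if_pos (le_inf_iff.1 hτ).1, if_pos (le_inf_iff.1 hτ).2, AddChar.inv_apply,
    ← AddChar.map_add_eq_mul, LinearMap.sub_comp, map_sub, sub_eq_add_neg]

/-- The entry of `C_(r,s)` at two pairs depends only on the intersection of the subspaces and the
rank of the difference there: the truncations of the defining sums are immaterial. -/
theorem matC_apply [FiniteDimensional F V] [FiniteDimensional F E] {m r s : ℕ}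
    (hs : s ≤ m) (p p' : Pairs F V E m) :
    matC F V E m r s p p' =
      if s ≤ finrank F (p.1.1 ⊓ p'.1.1 : Submodule F V) then
        gaussBinom (Nat.card F) ((finrank F (p.1.1 ⊓ p'.1.1 : Submodule F V) : ℤ) - s)
          ((r : ℤ) - s) *
        krawtchouk (Nat.card F) s (finrank F (p.1.1 ⊓ p'.1.1 : Submodule F V)) (finrank F E)
          (finrank F (LinearMap.range (restrictDiff p p'))) else 0 := by
  classical
  set a := finrank F (p.1.1 ⊓ p'.1.1 : Submodule F V) with ha
  set x := finrank F (LinearMap.range (restrictDiff p p')) with hx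
  have hA : ∀ i j, adjMat F V E m i j p p' = if (a : ℤ) = m - i ∧ x = j then 1 else 0 :=
    fun i j ↦ if_congr Iff.rfl rfl rfl
  have hB : ∀ i, matB F V E m i s p p' = if (a : ℤ) = m - i then
      krawtchouk (Nat.card F) s a (finrank F E) x else 0 := by
    intro i
    simp only [matB, Matrix.sum_apply, Matrix.smul_apply, hA, smul_eq_mul, mul_ite, mul_one,
      mul_zero]
    split_ifs with hi
    · have h1 : m - i = a := by omega
      have h2 : x ≤ a := (LinearMap.finrank_range_le _)
      have h3 : x ≤ finrank F E := Submodule.finrank_le _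
      simp only [hi, true_and, h1]
      rw [Finset.sum_ite_eq, if_pos (Finset.mem_range.2 (by omega))]
    · simp [hi]
  simp only [matC, Matrix.sum_apply, Matrix.smul_apply, hB, smul_eq_mul]
  have hdim := Submodule.finrank_sup_add_finrank_inf_eq p.1.1 p'.1.1
  have hle := (p.1.1 ⊔ p'.1.1).finrank_le
  have hle' := Submodule.finrank_mono (inf_le_left : p.1.1 ⊓ p'.1.1 ≤ p.1.1)
  rw [p.1.2, p'.1.2, ← ha] at hdim
  rw [p.1.2, ← ha] at hle'
  split_ifs with hsa
  · rw [Finset.sum_eq_single (m - a)]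
    · rw [if_pos (by omega), show (m : ℤ) - (m - a : ℕ) = a by omega]
    · intro i _ hi
      rw [if_neg (by omega), mul_zero]
    · intro h
      rw [Finset.mem_range] at h
      omega
  · refine Finset.sum_eq_zero fun i hi ↦ ?_
    rw [Finset.mem_range] at hi
    rw [if_neg (by omega), mul_zero]

end Phase

section Product

variable {F V E : Type*} [Field F] [Finite F] [AddCommGroup V] [Module F V] [FiniteDimensional F V]
  [AddCommGroup E] [Module F E] [FiniteDimensional F E]

open Classical in
/-- `C_(r,s)` is the sum of the rank-one matrices `v v*` over all `τ : E → V` of rank `s` and all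
`r`-dimensional `u` containing the range of `τ`, where `v (x, ξ)` is `ψ (tr (ξ τ))` if `u ≤ x` and
`0` otherwise. -/
theorem matC_apply_eq_sum {ψ : AddChar F ℂ} (hψ : ψ ≠ 1) {m r s : ℕ} (hs : s ≤ m)
    (p p' : Pairs F V E m) :
    matC F V E m r s p p' = ∑ τ : E →ₗ[F] V, if finrank F (LinearMap.range τ) = s then
      phase ψ p τ * phase ψ⁻¹ p' τ * intervalCount (LinearMap.range τ) (p.1.1 ⊓ p'.1.1) r
      else 0 := by
  have h1 : ∀ τ : E →ₗ[F] V, (if finrank F (LinearMap.range τ) = s then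
      phase ψ p τ * phase ψ⁻¹ p' τ * intervalCount (LinearMap.range τ) (p.1.1 ⊓ p'.1.1) r else 0) =
      if LinearMap.range τ ≤ p.1.1 ⊓ p'.1.1 then (if finrank F (LinearMap.range τ) = s then
        gaussBinom (Nat.card F) ((finrank F (p.1.1 ⊓ p'.1.1 : Submodule F V) : ℤ) - s) ((r : ℤ) - s) *
        ψ (LinearMap.trace F E ((extension p - extension p') ∘ₗ τ)) else 0) else 0 := by
    intro τ
    by_cases hτ : LinearMap.range τ ≤ p.1.1 ⊓ p'.1.1
    · rw [if_pos hτ]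
      split_ifs with h
      · rw [phase_mul_phase_inv ψ p p' τ hτ, intervalCount_eq hτ, h, mul_comm]
      · rfl
    · rw [intervalCount_of_not_le hτ, if_neg hτ]
      simp
  rw [Finset.sum_congr rfl fun τ _ ↦ h1 τ, sum_range_le, matC_apply hs]
  simp only [finrank_range_subtype_comp, ← LinearMap.comp_assoc, ← restrictDiff_eq]
  split_ifs with hsa
  · rw [← sum_addChar_trace_eq_krawtchouk hψ (restrictDiff p p') hsa, Finset.mul_sum]
    exact Finset.sum_congr rfl fun τ _ ↦ by rw [mul_ite, mul_zero]
  · refine (Finset.sum_eq_zero fun τ _ ↦ if_neg fun h ↦ hsa ?_).symm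
    rw [← h]
    exact Submodule.finrank_le _

open Classical in
/-- Orthogonality of the functions `phase ψ · τ` on the pairs with a fixed subspace. -/
theorem sum_phase_inv_mul_phase {ψ : AddChar F ℂ} (hψ : ψ ≠ 1) {m : ℕ}
    (z : {z : Submodule F V // finrank F z = m}) {τ τ' : E →ₗ[F] V}
    (hτ : LinearMap.range τ ≤ z.1) (hτ' : LinearMap.range τ' ≤ z.1) :
    ∑ ξ : z.1 →ₗ[F] E, phase ψ⁻¹ (⟨z, ξ⟩ : Pairs F V E m) τ * phase ψ (⟨z, ξ⟩ : Pairs F V E m) τ' =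
      if τ = τ' then (Nat.card F : ℂ) ^ (m * finrank F E) else 0 := by
  obtain ⟨σ, rfl⟩ : ∃ σ : E →ₗ[F] z.1, τ = z.1.subtype ∘ₗ σ :=
    ⟨τ.codRestrict z.1 fun e ↦ hτ (LinearMap.mem_range_self τ e), rfl⟩
  obtain ⟨σ', rfl⟩ : ∃ σ' : E →ₗ[F] z.1, τ' = z.1.subtype ∘ₗ σ' :=
    ⟨τ'.codRestrict z.1 fun e ↦ hτ' (LinearMap.mem_range_self τ' e), rfl⟩
  have h1 : ∀ ξ : z.1 →ₗ[F] E,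
      phase ψ⁻¹ (⟨z, ξ⟩ : Pairs F V E m) (z.1.subtype ∘ₗ σ) *
        phase ψ (⟨z, ξ⟩ : Pairs F V E m) (z.1.subtype ∘ₗ σ') =
      ψ (LinearMap.trace F z.1 ((σ' - σ) ∘ₗ ξ)) := by
    intro ξ
    have h2 := extension_comp_subtype (⟨z, ξ⟩ : Pairs F V E m)
    dsimp only at h2
    rw [phase, phase, if_pos hτ, if_pos hτ', ← LinearMap.comp_assoc, ← LinearMap.comp_assoc, h2,
      AddChar.inv_apply, ← AddChar.map_add_eq_mul, LinearMap.sub_comp, map_sub,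
      LinearMap.trace_comp_comm' σ ξ, LinearMap.trace_comp_comm' σ' ξ, neg_add_eq_sub]
  rw [Finset.sum_congr rfl fun ξ _ ↦ h1 ξ, sum_addChar_trace_comp hψ, z.2, mul_comm]
  refine if_congr ?_ rfl rfl
  rw [sub_eq_zero, LinearMap.cancel_left z.1.injective_subtype, eq_comm]

theorem sum_pairs {m : ℕ} (f : Pairs F V E m → ℂ) :
    ∑ p, f p = ∑ z : {z : Submodule F V // finrank F z = m}, ∑ ξ : z.1 →ₗ[F] E, f ⟨z, ξ⟩ := by
  rw [← Fintype.sum_sigma]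
  exact Finset.sum_congr (Finset.ext fun _ ↦ by simp) fun _ _ ↦ rfl

/-- The product of two of the matrices reduces to a count of subspaces `z` for each single `τ`. -/
theorem matC_mul_matC_apply {ψ : AddChar F ℂ} (hψ : ψ ≠ 1) {m r s k h : ℕ} (hs : s ≤ m) (hh : h ≤ m)
    (p p' : Pairs F V E m) :
    (matC F V E m r s * matC F V E m k h) p p' =
      if s = h then ∑ τ : E →ₗ[F] V, (if finrank F (LinearMap.range τ) = s then
        phase ψ p τ * phase ψ⁻¹ p' τ * ((Nat.card F : ℂ) ^ (m * finrank F E) *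
          ∑ z : {z : Submodule F V // finrank F z = m},
            intervalCount (LinearMap.range τ) (p.1.1 ⊓ z.1) r *
            intervalCount (LinearMap.range τ) (z.1 ⊓ p'.1.1) k) else 0)
      else 0 := by
  classical
  -- Only `τ = τ'` survives the sum over the middle pair.
  have h1 : ∀ τ τ' : E →ₗ[F] V, ∑ z : {z : Submodule F V // finrank F z = m},
      ∑ ξ : z.1 →ₗ[F] E,
      ((if finrank F (LinearMap.range τ) = s then
          phase ψ p τ * phase ψ⁻¹ (⟨z, ξ⟩ : Pairs F V E m) τ *
            intervalCount (LinearMap.range τ) (p.1.1 ⊓ z.1) r else 0) *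
        (if finrank F (LinearMap.range τ') = h then
          phase ψ (⟨z, ξ⟩ : Pairs F V E m) τ' * phase ψ⁻¹ p' τ' *
            intervalCount (LinearMap.range τ') (z.1 ⊓ p'.1.1) k else 0)) =
      if τ = τ' then (if s = h then if finrank F (LinearMap.range τ) = s then
        phase ψ p τ * phase ψ⁻¹ p' τ * ((Nat.card F : ℂ) ^ (m * finrank F E) *
          ∑ z : {z : Submodule F V // finrank F z = m},
            intervalCount (LinearMap.range τ) (p.1.1 ⊓ z.1) r *
            intervalCount (LinearMap.range τ) (z.1 ⊓ p'.1.1) k) else 0 else 0) else 0 := by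
    intro τ τ'
    by_cases hτ : finrank F (LinearMap.range τ) = s
    swap
    · simp [hτ]
    by_cases hτ' : finrank F (LinearMap.range τ') = h
    swap
    · simp only [if_neg hτ', mul_zero, Finset.sum_const_zero]
      by_cases hττ : τ = τ'
      · subst hττ
        rw [if_neg (show s ≠ h from fun hsh ↦ hτ' (hτ.trans hsh))]
        simp
      · rw [if_neg hττ]
    have h2 : ∀ z : {z : Submodule F V // finrank F z = m},
        ∑ ξ : z.1 →ₗ[F] E, phase ψ p τ * phase ψ⁻¹ (⟨z, ξ⟩ : Pairs F V E m) τ *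
          intervalCount (LinearMap.range τ) (p.1.1 ⊓ z.1) r *
          (phase ψ (⟨z, ξ⟩ : Pairs F V E m) τ' * phase ψ⁻¹ p' τ' *
            intervalCount (LinearMap.range τ') (z.1 ⊓ p'.1.1) k) =
        phase ψ p τ * phase ψ⁻¹ p' τ' *
          ((if τ = τ' then (Nat.card F : ℂ) ^ (m * finrank F E) else 0) *
          (intervalCount (LinearMap.range τ) (p.1.1 ⊓ z.1) r *
            intervalCount (LinearMap.range τ') (z.1 ⊓ p'.1.1) k)) := by
      intro z
      by_cases hz : LinearMap.range τ ≤ p.1.1 ⊓ z.1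
      swap
      · simp [intervalCount_of_not_le hz]
      by_cases hz' : LinearMap.range τ' ≤ z.1 ⊓ p'.1.1
      swap
      · simp [intervalCount_of_not_le hz']
      rw [← sum_phase_inv_mul_phase hψ z (le_inf_iff.1 hz).2 (le_inf_iff.1 hz').1,
        Finset.sum_mul, Finset.mul_sum]
      exact Finset.sum_congr rfl fun ξ _ ↦ by ring
    simp only [if_pos hτ, if_pos hτ']
    rw [Finset.sum_congr rfl fun z _ ↦ h2 z, ← Finset.mul_sum, ← Finset.mul_sum]
    by_cases hττ : τ = τ'
    · subst hττ
      rw [if_pos rfl, if_pos rfl, if_pos (hτ.symm.trans hτ')]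
    · simp [hττ]
  rw [Matrix.mul_apply, sum_pairs]
  simp_rw [matC_apply_eq_sum hψ hs, matC_apply_eq_sum hψ hh, Finset.sum_mul_sum]
  have h3 : ∀ g : (z : {z : Submodule F V // finrank F z = m}) → (z.1 →ₗ[F] E) →
      (E →ₗ[F] V) → (E →ₗ[F] V) → ℂ,
      ∑ z, ∑ ξ, ∑ τ, ∑ τ', g z ξ τ τ' = ∑ τ, ∑ τ', ∑ z, ∑ ξ, g z ξ τ τ' := by
    intro g
    calc _ = ∑ z, ∑ τ, ∑ ξ, ∑ τ', g z ξ τ τ' := Finset.sum_congr rfl fun z _ ↦ Finset.sum_comm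
      _ = ∑ z, ∑ τ, ∑ τ', ∑ ξ, g z ξ τ τ' :=
        Finset.sum_congr rfl fun z _ ↦ Finset.sum_congr rfl fun τ _ ↦ Finset.sum_comm
      _ = ∑ τ, ∑ z, ∑ τ', ∑ ξ, g z ξ τ τ' := Finset.sum_comm
      _ = _ := Finset.sum_congr rfl fun τ _ ↦ Finset.sum_comm
  rw [h3]
  simp only [h1, Finset.sum_ite_eq, Finset.mem_univ, if_true]
  split_ifs <;> simp

end Product

end Attenuated

end

theorem lemma2p1 {F V E : Type*} [Field F] [Finite F]
    [AddCommGroup V] [Module F V] [FiniteDimensional F V]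
    [AddCommGroup E] [Module F E] [FiniteDimensional F E]
    (q n l m : ℕ) (hq : Nat.card F = q) (hn : Module.finrank F V = n)
    (hl : Module.finrank F E = l) (hmn : m ≤ n)
    (r s k h : ℕ) (hrs : (r, s) ∈ Attenuated.indexL n m l)
    (hkh : (k, h) ∈ Attenuated.indexL n m l) :
    Attenuated.matC F V E m r s * Attenuated.matC F V E m k h =
      ∑ i ∈ Finset.Icc s (min r k),
        Attenuated.beta q n m l r s k h i • Attenuated.matC F V E m i s := by
  classical
  have hq0 : (q : ℂ) ≠ 0 := by
    have : 1 < Nat.card F := Finite.one_lt_card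
    exact_mod_cast (by omega : q ≠ 0)
  have hs : s ≤ m := hrs.1.trans (min_le_left _ _)
  have hh : h ≤ m := hkh.1.trans (min_le_left _ _)
  obtain ⟨ψ, hψ⟩ : ∃ ψ : AddChar F ℂ, ψ ≠ 1 := by
    obtain ⟨ψ, hψ⟩ := AddChar.exists_apply_ne_zero.2 (one_ne_zero (α := F))
    exact ⟨ψ, AddChar.ne_one_iff.2 ⟨1, hψ⟩⟩
  ext p p'
  rw [Attenuated.matC_mul_matC_apply hψ hs hh, Matrix.sum_apply]
  simp only [Matrix.smul_apply, smul_eq_mul, Attenuated.matC_apply_eq_sum hψ hs]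
  by_cases hsh : s = h
  swap
  · simp [hsh, Attenuated.beta]
  rw [if_pos hsh]
  conv_rhs => rw [Finset.sum_congr rfl fun i _ ↦ Finset.mul_sum _ _ _, Finset.sum_comm]
  refine Finset.sum_congr rfl fun τ _ ↦ ?_
  split_ifs with hτ
  swap
  · simp
  rw [Attenuated.sum_intervalCount_mul_intervalCount p.1.2 p'.1.2 hrs.2.1 hkh.2.1, hτ, hq, hn, hl,
    Finset.mul_sum, Finset.mul_sum]
  refine Finset.sum_congr rfl fun i _ ↦ ?_
  rw [Attenuated.beta, if_pos hsh, zpow_add₀ hq0, ← Nat.cast_mul, zpow_natCast]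
  ring
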